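/- **Theorem 1.3.** Let $\Omega$ be a non-empty finite set, and let $\mathcal P(\Omega)$ be the set of probability distributions on $\Omega$, identified with the standard simplex in $\mathbb R^\Omega$ and equipped with its Borel $\sigma$-algebra. Let $\mathbb S$ be the set of measurable bijections $\varphi:[0,1]\to[0,1]$ such that $\varphi$ and $\varphi^{-1}$ preserve the Lebesgue measure. *Kernels.* Let $\mathcal K$ be the set of measurable maps $\kappa:[0,1]^2\to\mathcal P(\Omega)$, $(s,x)\mapsto\kappa_{s,x}$, up to equality almost everywhere, and for $\kappa,\kappa'\in\mathcal K$ let $$D_{\boxtimes}(\kappa,\kappa')=\inf_{\varphi,\varphi'\in\mathbb S}\ \sup_{S,X\subset[0,1],\ \omega\in\Omega}\left|\int_S\int_X\left(\kappa_{s,x}(\omega)-\kappa'_{\varphi(s),\varphi'(x)}(\omega)\right)\mathrm dx\,\mathrm ds\right|,$$ where $S,X$ range over measurable sets. This is a pseudometric on $\mathcal K$; let $\mathfrak K$ be the metric space obtained from $\mathcal K$ by identifying $\kappa,\kappa'$ whenever $D_{\boxtimes}(\kappa,\kappa')=0$. *Laws.* Let $\mathcal S$ be the set of measurable maps $\sigma:[0,1]\to\mathcal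 P(\Omega)$, $x\mapsto\sigma_x$, up to equality almost everywhere, with the metric $D_1(\sigma,\tau)=\sum_{\omega\in\Omega}\int_0^1|\sigma_x(\omega)-\tau_x(\omega)|\,\mathrm dx$ and the corresponding Borel $\sigma$-algebra. Let $\mathcal L$ be the set of probability measures on $\mathcal S$, and for $\mu,\nu\in\mathcal L$ let $$D_{\boxtimes}(\mu,\nu)=\inf_{\gamma\in\Gamma(\mu,\nu),\ \varphi\in\mathbb S}\ \sup_{S\subset\mathcal S\times\mathcal S,\ X\subset[0,1],\ \omega\in\Omega}\left|\int_S\int_X\left(\sigma_x(\omega)-\tau_{\varphi(x)}(\omega)\right)\mathrm dx\,\mathrm d\gamma(\sigma,\tau)\right|,$$ where $\Gamma(\mu,\nu)$ is the set of couplings of $\mu,\nu$ (probability measures on $\mathcal S\times\mathcal S$ with marginals $\mu,\nu$) and $S,X$ range over measurable sets. This is a pseudometric on $\mathcal L$; let $\mathfrak L$ be the metric space obtained from $\mathcal L$ by identifying $\mu,\nu$ whenever $D_{\boxtimes}(\mu,\nu)=0$. The points of $\mathfrak L$ are called $\Omega$-laws. For $\kappa\in\mathcal K$ let $\mu^\kappa\in\mathcal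 L$ be the distribution of $\kappa_{\boldsymbol s}:x\mapsto\kappa_{\boldsymbol s,x}$ for a uniformly random $\boldsymbol s\in[0,1]$. Then $\kappa\mapsto\mu^\kappa$ induces a well-defined map $\mathfrak K\to\mathfrak L$, and this map is an isometric bijection. -/

import Mathlib

open MeasureTheory

namespace CutMetric

noncomputable section

/-! ### Configurations: the space of measurable maps from the unit interval to the simplex -/

/-- Measurable maps `σ : [0,1] → 𝒫(Ω)` up to almost everywhere equality. The set `𝒫(Ω)` of
probability distributions on the finite set `Ω` is the standard simplex in `Ω → ℝ`. -/
def Config (Ω : Type*) [Fintype Ω] : Type _ := unitInterval →ₘ[(volume : Measure unitInterval)] (stdSimplex ℝ Ω)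

/-- `σ.prob x ω` is the number `σ_x(ω)`, read off a measurable representative of `σ`. -/
def Config.prob {Ω : Type*} [Fintype Ω] (σ : Config Ω) (x : unitInterval) (ω : Ω) : ℝ :=
  (AEEqFun.cast σ x : stdSimplex ℝ Ω).1 ω

section Config

variable {Ω : Type*} [Fintype Ω]

theorem Config.measurable_prob (σ : Config Ω) (ω : Ω) : Measurable fun x => σ.prob x ω :=
  (measurable_pi_apply ω).comp (measurable_subtype_coe.comp (AEEqFun.measurable σ))

theorem Config.prob_nonneg (σ : Config Ω) (x : unitInterval) (ω : Ω) : 0 ≤ σ.prob x ω :=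
  (AEEqFun.cast σ x : stdSimplex ℝ Ω).2.1 ω

theorem Config.sum_prob (σ : Config Ω) (x : unitInterval) : ∑ ω, σ.prob x ω = 1 :=
  (AEEqFun.cast σ x : stdSimplex ℝ Ω).2.2

theorem Config.prob_le_one (σ : Config Ω) (x : unitInterval) (ω : Ω) : σ.prob x ω ≤ 1 := by
  rw [← σ.sum_prob x]
  exact Finset.single_le_sum (fun i _ => σ.prob_nonneg x i) (Finset.mem_univ ω)

theorem Config.integrable_prob (σ : Config Ω) (ω : Ω) : Integrable fun x => σ.prob x ω := by
  refine Integrable.of_bound (σ.measurable_prob ω).aestronglyMeasurable 1 (.of_forall fun x => ?_)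
  rw [Real.norm_eq_abs, abs_of_nonneg (σ.prob_nonneg x ω)]
  exact σ.prob_le_one x ω

theorem Config.ext_ae {σ τ : Config Ω} (h : ∀ ω, ∀ᵐ x, σ.prob x ω = τ.prob x ω) : σ = τ := by
  refine AEEqFun.ext (α := unitInterval) (β := stdSimplex ℝ Ω) ?_
  filter_upwards [ae_all_iff.2 h] with x hx
  exact Subtype.ext (funext hx)

/-- The coordinates of a configuration as an element of `L¹`. -/
def Config.toL1 (σ : Config Ω) : PiLp 1 (fun _ : Ω => Lp ℝ 1 (volume : Measure unitInterval)) :=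
  WithLp.toLp 1 fun ω => (σ.integrable_prob ω).toL1 _

theorem Config.dist_toL1 (σ τ : Config Ω) :
    dist σ.toL1 τ.toL1 = ∑ ω, ∫ x, |σ.prob x ω - τ.prob x ω| := by
  rw [PiLp.dist_eq_of_L1]
  refine Finset.sum_congr rfl fun ω _ => ?_
  change dist ((σ.integrable_prob ω).toL1 _) ((τ.integrable_prob ω).toL1 _) = _
  rw [dist_eq_norm, ← Integrable.toL1_sub, L1.norm_eq_integral_norm]
  refine integral_congr_ae ?_
  filter_upwards [Integrable.coeFn_toL1 ((σ.integrable_prob ω).sub (τ.integrable_prob ω))]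
    with x hx
  rw [hx, Real.norm_eq_abs, Pi.sub_apply]

theorem Config.toL1_injective : Function.Injective (Config.toL1 (Ω := Ω)) := by
  intro σ τ h
  refine Config.ext_ae fun ω => ?_
  have h' : (σ.integrable_prob ω).toL1 _ = (τ.integrable_prob ω).toL1 _ :=
    congrFun (congrArg WithLp.ofLp h) ω
  exact (Integrable.toL1_eq_toL1_iff _ _ _ _).1 h'

/-- The `L¹`-metric `D₁(σ, τ) = ∑_ω ∫ |σ_x(ω) - τ_x(ω)| dx` on configurations. -/
instance Config.instMetricSpace : MetricSpace (Config Ω) where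
  dist σ τ := ∑ ω, ∫ x, |σ.prob x ω - τ.prob x ω|
  dist_self σ := by simp
  dist_comm σ τ := by simp only [abs_sub_comm]
  dist_triangle σ τ ρ := by
    simpa only [Config.dist_toL1] using dist_triangle σ.toL1 τ.toL1 ρ.toL1
  eq_of_dist_eq_zero {σ τ} h :=
    Config.toL1_injective (eq_of_dist_eq_zero ((Config.dist_toL1 σ τ).trans h))

theorem Config.dist_def (σ τ : Config Ω) :
    dist σ τ = ∑ ω, ∫ x, |σ.prob x ω - τ.prob x ω| := rfl

theorem Config.isometry_toL1 : Isometry (Config.toL1 (Ω := Ω)) :=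
  Isometry.of_dist_eq fun σ τ => Config.dist_toL1 σ τ

/-- The Borel `σ`-algebra of the `L¹`-metric. -/
instance Config.instMeasurableSpace : MeasurableSpace (Config Ω) := borel _

instance Config.instBorelSpace : BorelSpace (Config Ω) := ⟨rfl⟩

/-- The configuration with a given measurable representative. -/
def Config.mk (f : unitInterval → stdSimplex ℝ Ω) (hf : Measurable f) : Config Ω :=
  (AEEqFun.mk f hf.aestronglyMeasurable : unitInterval →ₘ[(volume : Measure unitInterval)] (stdSimplex ℝ Ω))

theorem Config.prob_mk (f : unitInterval → stdSimplex ℝ Ω) (hf : Measurable f) :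
    ∀ᵐ x, ∀ ω, (Config.mk f hf).prob x ω = (f x).1 ω := by
  have h := AEEqFun.coeFn_mk (μ := (volume : Measure unitInterval)) f hf.aestronglyMeasurable
  filter_upwards [h] with x hx ω
  exact congrArg (fun p : stdSimplex ℝ Ω => p.1 ω) hx

instance Config.instNonempty [Nonempty Ω] : Nonempty (Config Ω) := by
  classical
  exact ⟨Config.mk (fun _ => ⟨_, single_mem_stdSimplex ℝ (Classical.arbitrary Ω)⟩)
    measurable_const⟩

theorem Config.isClosed_range_toL1 [Nonempty Ω] :
    IsClosed (Set.range (Config.toL1 (Ω := Ω))) := by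
  classical
  let one : Lp ℝ 1 (volume : Measure unitInterval) := (integrable_const (1 : ℝ)).toL1 _
  have hset : Set.range (Config.toL1 (Ω := Ω)) =
      {f : PiLp 1 (fun _ : Ω => Lp ℝ 1 (volume : Measure unitInterval)) |
        (∀ ω, 0 ≤ f ω) ∧ ∑ ω, f ω = one} := by
    ext f
    constructor
    · rintro ⟨σ, rfl⟩
      have hco := fun ω => Integrable.coeFn_toL1 (σ.integrable_prob ω)
      refine ⟨fun ω => ?_, ?_⟩
      · change 0 ≤ (σ.integrable_prob ω).toL1 _
        rw [← Lp.coeFn_nonneg]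
        filter_upwards [hco ω] with x hx
        rw [hx]
        exact σ.prob_nonneg x ω
      · change ∑ ω, (σ.integrable_prob ω).toL1 _ = one
        refine Lp.ext ?_
        filter_upwards [Lp.coeFn_fun_finsetSum (Finset.univ : Finset Ω)
            (fun ω => (σ.integrable_prob ω).toL1 _), ae_all_iff.2 hco,
          Integrable.coeFn_toL1 (integrable_const (μ := (volume : Measure unitInterval)) (1 : ℝ))]
          with x h1 h2 h3
        rw [h1, h3, ← σ.sum_prob x]
        exact Finset.sum_congr rfl fun ω _ => h2 ω
    · rintro ⟨h0, h1⟩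
      have hm : ∀ ω, Measurable (f ω : unitInterval → ℝ) := fun ω => (Lp.stronglyMeasurable (f ω)).measurable
      have hmv : Measurable fun x : unitInterval => fun ω => (f ω : unitInterval → ℝ) x :=
        measurable_pi_lambda _ hm
      have hS : MeasurableSet (stdSimplex ℝ Ω) := (isClosed_stdSimplex ℝ Ω).measurableSet
      let e : stdSimplex ℝ Ω := ⟨_, single_mem_stdSimplex ℝ (Classical.arbitrary Ω)⟩
      let A : Set unitInterval := {x | (fun ω => (f ω : unitInterval → ℝ) x) ∈ stdSimplex ℝ Ω}
      have hA : MeasurableSet A := hmv hS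
      let g : unitInterval → stdSimplex ℝ Ω := fun x =>
        if h : (fun ω => (f ω : unitInterval → ℝ) x) ∈ stdSimplex ℝ Ω then ⟨_, h⟩ else e
      have hg : Measurable g := by
        refine Measurable.dite (s := A) (f := fun x : A => (⟨_, x.2⟩ : stdSimplex ℝ Ω))
          (g := fun _ => e) ?_ measurable_const hA
        exact (hmv.comp measurable_subtype_coe).subtype_mk
      have hae : ∀ᵐ x, x ∈ A := by
        filter_upwards [Lp.coeFn_fun_finsetSum (Finset.univ : Finset Ω) (fun ω => f ω),
          ae_all_iff.2 fun ω => (Lp.coeFn_nonneg (f ω)).2 (h0 ω),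
          Integrable.coeFn_toL1 (integrable_const (μ := (volume : Measure unitInterval)) (1 : ℝ))]
          with x hx1 hx2 hx3
        refine ⟨hx2, ?_⟩
        rw [h1] at hx1
        exact hx1.symm.trans hx3
      refine ⟨Config.mk g hg, ?_⟩
      refine PiLp.ext fun ω => ?_
      refine Lp.ext ?_
      filter_upwards [Integrable.coeFn_toL1 ((Config.mk g hg).integrable_prob ω),
        Config.prob_mk g hg, hae] with x hx1 hx2 hx3
      refine hx1.trans ((hx2 ω).trans ?_)
      have : g x = ⟨_, hx3⟩ := dif_pos hx3
      rw [this]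
  rw [hset]
  have hc : ∀ ω : Ω, Continuous fun f : PiLp 1 (fun _ : Ω => Lp ℝ 1 (volume : Measure unitInterval)) => f ω :=
    fun ω => PiLp.continuous_apply 1 _ ω
  refine IsClosed.and ?_ ?_
  · rw [Set.ofPred_forall]
    exact isClosed_iInter fun ω => isClosed_le continuous_const (hc ω)
  · exact isClosed_eq (continuous_finsetSum _ fun ω _ => hc ω) continuous_const

instance Config.instPolishSpace [Nonempty Ω] : PolishSpace (Config Ω) := by
  have h : Topology.IsClosedEmbedding (Config.toL1 (Ω := Ω)) :=
    ⟨Config.isometry_toL1.isEmbedding, Config.isClosed_range_toL1⟩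
  have : SecondCountableTopology (PiLp 1 (fun _ : Ω => Lp ℝ 1 (volume : Measure unitInterval))) := by
    have : Fact ((1 : ENNReal) ≠ ⊤) := ⟨ENNReal.one_ne_top⟩
    infer_instance
  have : PolishSpace (PiLp 1 (fun _ : Ω => Lp ℝ 1 (volume : Measure unitInterval))) := inferInstance
  exact h.polishSpace

end Config

/-! ### Measure-preserving reparametrisations of the unit interval -/

/-- Measurable bijections `φ` of `[0,1]` such that `φ` and `φ⁻¹` preserve the Lebesgue measure
(measurability and measure preservation of `φ⁻¹` follow from those of `φ`). -/
def Reparam : Type :=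
  {φ : unitInterval ≃ᵐ unitInterval // MeasurePreserving φ volume volume}

namespace Reparam

instance : CoeFun Reparam fun _ => unitInterval → unitInterval := ⟨fun φ => φ.1⟩

/-- The identity. -/
def refl : Reparam := ⟨MeasurableEquiv.refl _, MeasurePreserving.id _⟩

/-- The inverse bijection. -/
def symm (φ : Reparam) : Reparam := ⟨φ.1.symm, φ.2.symm φ.1⟩

/-- The composition `x ↦ ψ (φ x)`. -/
def trans (φ ψ : Reparam) : Reparam := ⟨φ.1.trans ψ.1, ψ.2.comp φ.2⟩

instance : Nonempty Reparam := ⟨refl⟩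

theorem measurable (φ : Reparam) : Measurable φ := φ.1.measurable

theorem setIntegral_comp (φ : Reparam) (f : unitInterval → ℝ) (X : Set unitInterval) :
    ∫ x in X, f (φ x) = ∫ x in φ '' X, f x :=
  (φ.2.setIntegral_image_emb φ.1.measurableEmbedding f X).symm

theorem measurableSet_image (φ : Reparam) {X : Set unitInterval} (hX : MeasurableSet X) :
    MeasurableSet (φ '' X) :=
  φ.1.measurableEmbedding.measurableSet_image.2 hX

end Reparam

theorem iInf_le_iInf_add_iInf {ι₁ ι₂ ι₃ : Type*} [Nonempty ι₁] [Nonempty ι₂] {f : ι₁ → ℝ}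
    {g : ι₂ → ℝ} {h : ι₃ → ℝ} (h0 : ∀ k, 0 ≤ h k) (H : ∀ i j, ∃ k, h k ≤ f i + g j) :
    ⨅ k, h k ≤ (⨅ i, f i) + ⨅ j, g j := by
  refine le_ciInf_add_ciInf fun i j => ?_
  obtain ⟨k, hk⟩ := H i j
  exact (ciInf_le ⟨0, by rintro _ ⟨l, rfl⟩; exact h0 l⟩ k).trans hk

theorem iInf_le_iInf_of_exists {ι₁ ι₂ : Type*} [Nonempty ι₁] {f : ι₁ → ℝ} {h : ι₂ → ℝ}
    (h0 : ∀ k, 0 ≤ h k) (H : ∀ i, ∃ k, h k ≤ f i) : ⨅ k, h k ≤ ⨅ i, f i := by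
  refine le_ciInf fun i => ?_
  obtain ⟨k, hk⟩ := H i
  exact (ciInf_le ⟨0, by rintro _ ⟨l, rfl⟩; exact h0 l⟩ k).trans hk

/-! ### Kernels and their cut distance -/

/-- Kernels: measurable maps `κ : [0,1]² → 𝒫(Ω)` up to almost everywhere equality. -/
def CutKernel (Ω : Type*) [Fintype Ω] : Type _ :=
  (unitInterval × unitInterval) →ₘ[(volume : Measure (unitInterval × unitInterval))]
    (stdSimplex ℝ Ω)

namespace CutKernel

variable {Ω : Type*} [Fintype Ω]

/-- `κ.val s x` is the distribution `κ_{s,x}`, read off a measurable representative of `κ`. -/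
def val (κ : CutKernel Ω) (s x : unitInterval) : stdSimplex ℝ Ω :=
  AEEqFun.cast κ (s, x)

/-- `κ.prob s x ω` is the number `κ_{s,x}(ω)`. -/
def prob (κ : CutKernel Ω) (s x : unitInterval) (ω : Ω) : ℝ := (κ.val s x).1 ω

theorem measurable_val (κ : CutKernel Ω) :
    Measurable fun p : unitInterval × unitInterval => κ.val p.1 p.2 :=
  AEEqFun.measurable κ

theorem measurable_prob (κ : CutKernel Ω) (ω : Ω) :
    Measurable fun p : unitInterval × unitInterval => κ.prob p.1 p.2 ω :=
  (measurable_pi_apply ω).comp (measurable_subtype_coe.comp κ.measurable_val)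

theorem prob_nonneg (κ : CutKernel Ω) (s x : unitInterval) (ω : Ω) : 0 ≤ κ.prob s x ω :=
  (κ.val s x).2.1 ω

theorem prob_le_one (κ : CutKernel Ω) (s x : unitInterval) (ω : Ω) : κ.prob s x ω ≤ 1 := by
  have h : ∑ ω, κ.prob s x ω = 1 := (κ.val s x).2.2
  rw [← h]
  exact Finset.single_le_sum (fun i _ => κ.prob_nonneg s x i) (Finset.mem_univ ω)

/-- The largest discrepancy
`sup_{S, X, ω} |∫_S ∫_X κ_{s,x}(ω) - κ'_{φ(s),ψ(x)}(ω) dx ds|` of two kernels that are aligned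
by `φ` and `ψ`, where `S`, `X` range over the measurable subsets of `[0,1]`. -/
def discrepancy (κ κ' : CutKernel Ω) (φ ψ : Reparam) : ℝ :=
  ⨆ q : {S : Set unitInterval // MeasurableSet S} × {X : Set unitInterval // MeasurableSet X} × Ω,
    |∫ s in q.1.1, ∫ x in q.2.1.1, (κ.prob s x q.2.2 - κ'.prob (φ s) (ψ x) q.2.2)|

/-- The cut distance of kernels: the infimum of the discrepancies over all `φ`, `ψ`. -/
def cutDist (κ κ' : CutKernel Ω) : ℝ :=
  ⨅ p : Reparam × Reparam, discrepancy κ κ' p.1 p.2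

theorem abs_sub_le_one (κ κ' : CutKernel Ω) (s x s' x' : unitInterval) (ω : Ω) :
    |κ.prob s x ω - κ'.prob s' x' ω| ≤ 1 := by
  rw [abs_le]
  constructor <;> linarith [κ.prob_nonneg s x ω, κ.prob_le_one s x ω, κ'.prob_nonneg s' x' ω,
    κ'.prob_le_one s' x' ω]

theorem abs_setIntegral_le {α : Type*} [MeasurableSpace α] {μ : Measure α}
    [IsProbabilityMeasure μ] {f : α → ℝ} (hf : ∀ x, |f x| ≤ 1) (X : Set α) :
    |∫ x in X, f x ∂μ| ≤ 1 := by
  have h := norm_setIntegral_le_of_norm_le_const (μ := μ) (s := X) (f := f) (C := 1)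
    (measure_lt_top μ X) (fun x _ => hf x)
  rw [one_mul, Real.norm_eq_abs] at h
  exact h.trans measureReal_le_one

theorem le_discrepancy (κ κ' : CutKernel Ω) (φ ψ : Reparam) {S X : Set unitInterval}
    (hS : MeasurableSet S) (hX : MeasurableSet X) (ω : Ω) :
    |∫ s in S, ∫ x in X, (κ.prob s x ω - κ'.prob (φ s) (ψ x) ω)| ≤ discrepancy κ κ' φ ψ := by
  refine le_ciSup (f := fun q : {S : Set unitInterval // MeasurableSet S} ×
    {X : Set unitInterval // MeasurableSet X} × Ω =>
    |∫ s in q.1.1, ∫ x in q.2.1.1, (κ.prob s x q.2.2 - κ'.prob (φ s) (ψ x) q.2.2)|) ?_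
    (⟨S, hS⟩, ⟨X, hX⟩, ω)
  refine ⟨1, ?_⟩
  rintro _ ⟨q, rfl⟩
  exact abs_setIntegral_le (fun s => abs_setIntegral_le (fun x => abs_sub_le_one _ _ _ _ _ _ _) _) _

theorem discrepancy_nonneg (κ κ' : CutKernel Ω) (φ ψ : Reparam) : 0 ≤ discrepancy κ κ' φ ψ :=
  Real.iSup_nonneg fun _ => abs_nonneg _

theorem discrepancy_le (κ κ' : CutKernel Ω) (φ ψ : Reparam) {c : ℝ} (hc : 0 ≤ c)
    (H : ∀ S X : Set unitInterval, MeasurableSet S → MeasurableSet X → ∀ ω,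
      |∫ s in S, ∫ x in X, (κ.prob s x ω - κ'.prob (φ s) (ψ x) ω)| ≤ c) :
    discrepancy κ κ' φ ψ ≤ c :=
  Real.iSup_le (fun q => H _ _ q.1.2 q.2.1.2 _) hc

theorem setIntegral_comp (φ ψ : Reparam) (F : unitInterval → unitInterval → ℝ)
    (S X : Set unitInterval) :
    ∫ s in S, ∫ x in X, F (φ s) (ψ x) = ∫ s in φ '' S, ∫ x in ψ '' X, F s x := by
  rw [← φ.setIntegral_comp (fun s => ∫ x in ψ '' X, F s x) S]
  simp only [← ψ.setIntegral_comp]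

theorem setIntegral_add {F G : unitInterval → unitInterval → ℝ}
    (hF : Measurable (Function.uncurry F)) (hG : Measurable (Function.uncurry G))
    (hF1 : ∀ s x, |F s x| ≤ 1) (hG1 : ∀ s x, |G s x| ≤ 1) (S X : Set unitInterval) :
    ∫ s in S, ∫ x in X, (F s x + G s x) =
      (∫ s in S, ∫ x in X, F s x) + ∫ s in S, ∫ x in X, G s x := by
  have key : ∀ H : unitInterval → unitInterval → ℝ, Measurable (Function.uncurry H) →
      (∀ s x, |H s x| ≤ 1) → (∀ s, Integrable (H s) (volume.restrict X)) ∧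
        Integrable (fun s => ∫ x in X, H s x) (volume.restrict S) := by
    intro H hH hH1
    constructor
    · intro s
      exact Integrable.of_bound (hH.comp measurable_prodMk_left).aestronglyMeasurable 1
        (.of_forall (hH1 s))
    · refine Integrable.of_bound ?_ 1 (.of_forall fun s => abs_setIntegral_le (hH1 s) X)
      exact (hH.stronglyMeasurable.integral_prod_right (ν := volume.restrict X)).aestronglyMeasurable
  rw [← integral_add (key F hF hF1).2 (key G hG hG1).2]
  exact integral_congr_ae (.of_forall fun s =>
    integral_add ((key F hF hF1).1 s) ((key G hG hG1).1 s))

theorem discrepancy_refl (κ : CutKernel Ω) : discrepancy κ κ Reparam.refl Reparam.refl = 0 := by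
  refine le_antisymm (discrepancy_le _ _ _ _ le_rfl fun S X _ _ ω => ?_) (discrepancy_nonneg _ _ _ _)
  have : ∀ s x, κ.prob s x ω - κ.prob (Reparam.refl s) (Reparam.refl x) ω = 0 :=
    fun s x => sub_self _
  simp only [this, integral_zero, abs_zero, le_refl]

theorem discrepancy_symm_le (κ κ' : CutKernel Ω) (φ ψ : Reparam) :
    discrepancy κ' κ φ.symm ψ.symm ≤ discrepancy κ κ' φ ψ := by
  refine discrepancy_le _ _ _ _ (discrepancy_nonneg _ _ _ _) fun S X hS hX ω => ?_
  have h := setIntegral_comp φ.symm ψ.symm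
    (fun s x => κ'.prob (φ s) (ψ x) ω - κ.prob s x ω) S X
  have e : ∀ (φ : Reparam) s, φ (φ.symm s) = s := fun φ s => φ.1.apply_symm_apply s
  simp only [e] at h
  rw [h]
  have h2 : ∀ s x, κ'.prob (φ s) (ψ x) ω - κ.prob s x ω =
    -(κ.prob s x ω - κ'.prob (φ s) (ψ x) ω) := fun s x => (neg_sub _ _).symm
  simp only [h2, integral_neg, abs_neg]
  exact le_discrepancy κ κ' φ ψ (φ.symm.measurableSet_image hS) (ψ.symm.measurableSet_image hX) ω

theorem discrepancy_trans_le (κ κ' κ'' : CutKernel Ω) (φ₁ ψ₁ φ₂ ψ₂ : Reparam) :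
    discrepancy κ κ'' (φ₁.trans φ₂) (ψ₁.trans ψ₂) ≤
      discrepancy κ κ' φ₁ ψ₁ + discrepancy κ' κ'' φ₂ ψ₂ := by
  refine discrepancy_le _ _ _ _ (add_nonneg (discrepancy_nonneg _ _ _ _)
    (discrepancy_nonneg _ _ _ _)) fun S X hS hX ω => ?_
  have h0 : ∀ s x, κ.prob s x ω - κ''.prob (φ₁.trans φ₂ s) (ψ₁.trans ψ₂ x) ω =
      (κ.prob s x ω - κ'.prob (φ₁ s) (ψ₁ x) ω) +
        (κ'.prob (φ₁ s) (ψ₁ x) ω - κ''.prob (φ₂ (φ₁ s)) (ψ₂ (ψ₁ x)) ω) :=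
    fun s x => (sub_add_sub_cancel _ _ _).symm
  simp only [h0]
  rw [setIntegral_add]
  · have h := setIntegral_comp φ₁ ψ₁
      (fun s x => κ'.prob s x ω - κ''.prob (φ₂ s) (ψ₂ x) ω) S X
    rw [h]
    exact (abs_add_le _ _).trans (add_le_add (le_discrepancy κ κ' φ₁ ψ₁ hS hX ω)
      (le_discrepancy κ' κ'' φ₂ ψ₂ (φ₁.measurableSet_image hS) (ψ₁.measurableSet_image hX) ω))
  · exact (κ.measurable_prob ω).sub ((κ'.measurable_prob ω).comp
      (φ₁.measurable.prodMap ψ₁.measurable))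
  · exact ((κ'.measurable_prob ω).comp (φ₁.measurable.prodMap ψ₁.measurable)).sub
      ((κ''.measurable_prob ω).comp
        ((φ₂.measurable.comp φ₁.measurable).prodMap (ψ₂.measurable.comp ψ₁.measurable)))
  · exact fun s x => abs_sub_le_one _ _ _ _ _ _ _
  · exact fun s x => abs_sub_le_one _ _ _ _ _ _ _

/-- The cut distance is a pseudometric on kernels. -/
instance instPseudoMetricSpace : PseudoMetricSpace (CutKernel Ω) where
  dist := cutDist
  dist_self κ := by
    refine le_antisymm ?_ (Real.iInf_nonneg fun _ => discrepancy_nonneg _ _ _ _)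
    rw [← discrepancy_refl κ]
    exact ciInf_le (f := fun p : Reparam × Reparam => discrepancy κ κ p.1 p.2)
      ⟨0, by rintro _ ⟨p, rfl⟩; exact discrepancy_nonneg _ _ _ _⟩ (Reparam.refl, Reparam.refl)
  dist_comm κ κ' := by
    refine le_antisymm ?_ ?_ <;>
    exact iInf_le_iInf_of_exists (fun _ => discrepancy_nonneg _ _ _ _) fun p =>
      ⟨(p.1.symm, p.2.symm), discrepancy_symm_le _ _ _ _⟩
  dist_triangle κ κ' κ'' :=
    iInf_le_iInf_add_iInf (fun _ => discrepancy_nonneg _ _ _ _) fun p q =>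
      ⟨(p.1.trans q.1, p.2.trans q.2), discrepancy_trans_le _ _ _ _ _ _ _⟩

theorem dist_eq_cutDist (κ κ' : CutKernel Ω) : dist κ κ' = cutDist κ κ' := rfl

end CutKernel

/-! ### Laws and their cut distance -/

/-- A probability measure on the space of configurations. -/
structure ConfigLaw (Ω : Type*) [Fintype Ω] where
  /-- The underlying measure. -/
  measure : Measure (Config Ω)
  isProbabilityMeasure : IsProbabilityMeasure measure

attribute [instance] ConfigLaw.isProbabilityMeasure

/-- Couplings of `μ` and `ν`: measures on the product space with marginals `μ` and `ν`. -/
def Coupling {Ω : Type*} [Fintype Ω] (μ ν : ConfigLaw Ω) : Type _ :=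
  {γ : Measure (Config Ω × Config Ω) //
    γ.map Prod.fst = μ.measure ∧ γ.map Prod.snd = ν.measure}

namespace Config

variable {Ω : Type*} [Fintype Ω]

/-- The integral `∫_X σ_x(ω) - τ_{φ(x)}(ω) dx`. -/
def defect (φ : Reparam) (X : Set unitInterval) (ω : Ω) (p : Config Ω × Config Ω) : ℝ :=
  ∫ x in X, (p.1.prob x ω - p.2.prob (φ x) ω)

theorem abs_defect_le (φ : Reparam) (X : Set unitInterval) (ω : Ω) (p : Config Ω × Config Ω) :
    |defect φ X ω p| ≤ 1 := by
  refine CutKernel.abs_setIntegral_le (fun x => ?_) X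
  rw [abs_le]
  constructor <;> linarith [p.1.prob_nonneg x ω, p.1.prob_le_one x ω, p.2.prob_nonneg (φ x) ω,
    p.2.prob_le_one (φ x) ω]

theorem integrable_comp (σ : Config Ω) (φ : Reparam) (ω : Ω) :
    Integrable fun x => σ.prob (φ x) ω :=
  (φ.2.integrable_comp_emb φ.1.measurableEmbedding).2 (σ.integrable_prob ω)

theorem defect_eq (φ : Reparam) (X : Set unitInterval) (ω : Ω) (p : Config Ω × Config Ω) :
    defect φ X ω p = (∫ x in X, p.1.prob x ω) - ∫ x in φ '' X, p.2.prob x ω := by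
  rw [← φ.setIntegral_comp (fun x => p.2.prob x ω) X]
  exact integral_sub (p.1.integrable_prob ω).integrableOn (p.2.integrable_comp φ ω).integrableOn

theorem continuous_setIntegral (X : Set unitInterval) (ω : Ω) :
    Continuous fun σ : Config Ω => ∫ x in X, σ.prob x ω := by
  refine (LipschitzWith.of_dist_le_mul (K := 1) fun σ τ => ?_).continuous
  rw [NNReal.coe_one, one_mul, Real.dist_eq, ← integral_sub (σ.integrable_prob ω).integrableOn
    (τ.integrable_prob ω).integrableOn, dist_def]
  have hi : Integrable fun x => |σ.prob x ω - τ.prob x ω| :=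
    ((σ.integrable_prob ω).sub (τ.integrable_prob ω)).abs
  calc |∫ x in X, (σ.prob x ω - τ.prob x ω)| ≤ ∫ x in X, |σ.prob x ω - τ.prob x ω| :=
        abs_integral_le_integral_abs
    _ ≤ ∫ x, |σ.prob x ω - τ.prob x ω| :=
        setIntegral_le_integral hi (.of_forall fun _ => abs_nonneg _)
    _ ≤ _ := Finset.single_le_sum (f := fun ω => ∫ x, |σ.prob x ω - τ.prob x ω|)
        (fun _ _ => integral_nonneg fun _ => abs_nonneg _) (Finset.mem_univ ω)

theorem measurable_defect [Nonempty Ω] (φ : Reparam) (X : Set unitInterval) (ω : Ω) :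
    Measurable (defect (Ω := Ω) φ X ω) := by
  have h : defect (Ω := Ω) φ X ω =
      fun p => (∫ x in X, p.1.prob x ω) - ∫ x in φ '' X, p.2.prob x ω :=
    funext fun p => defect_eq φ X ω p
  rw [h]
  exact ((continuous_setIntegral X ω).measurable.comp measurable_fst).sub
    ((continuous_setIntegral (φ '' X) ω).measurable.comp measurable_snd)

theorem defect_refl (X : Set unitInterval) (ω : Ω) (σ : Config Ω) :
    defect Reparam.refl X ω (σ, σ) = 0 := by
  have : ∀ x, σ.prob x ω - σ.prob (Reparam.refl x) ω = 0 := fun x => sub_self _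
  simp only [defect, this, integral_zero]

theorem defect_symm (φ : Reparam) (X : Set unitInterval) (ω : Ω) (p : Config Ω × Config Ω) :
    defect φ.symm X ω p.swap = -defect φ (φ.symm '' X) ω p := by
  have h : φ '' (φ.symm '' X) = X := by
    rw [← Set.image_comp]
    have : (φ : unitInterval → unitInterval) ∘ φ.symm = id :=
      funext fun s => φ.1.apply_symm_apply s
    rw [this, Set.image_id]
  rw [defect_eq, defect_eq, h, neg_sub]
  rfl

theorem defect_trans (φ ψ : Reparam) (X : Set unitInterval) (ω : Ω) (σ τ ρ : Config Ω) :
    defect (φ.trans ψ) X ω (σ, ρ) = defect φ X ω (σ, τ) + defect ψ (φ '' X) ω (τ, ρ) := by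
  have h : (φ.trans ψ) '' X = ψ '' (φ '' X) := Set.image_comp ψ φ X
  rw [defect_eq, defect_eq, defect_eq, h]
  exact (sub_add_sub_cancel _ _ _).symm

end Config

namespace ConfigLaw

variable {Ω : Type*} [Fintype Ω]

/-- The largest discrepancy
`sup_{S, X, ω} |∫_S ∫_X σ_x(ω) - τ_{φ(x)}(ω) dx dγ(σ, τ)|` for a measure `γ` on pairs of
configurations and a reparametrisation `φ`, where `S` ranges over the measurable sets of pairs of
configurations and `X` over the measurable subsets of `[0,1]`. -/
def discrepancy (γ : Measure (Config Ω × Config Ω)) (φ : Reparam) : ℝ :=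
  ⨆ q : {S : Set (Config Ω × Config Ω) // MeasurableSet S} ×
      {X : Set unitInterval // MeasurableSet X} × Ω,
    |∫ p in q.1.1, (∫ x in q.2.1.1, (p.1.prob x q.2.2 - p.2.prob (φ x) q.2.2)) ∂γ|

/-- The cut distance of laws: the infimum of the discrepancies over all couplings `γ` and
all `φ`. -/
def cutDist (μ ν : ConfigLaw Ω) : ℝ :=
  ⨅ p : Coupling μ ν × Reparam, discrepancy p.1.1 p.2

theorem le_discrepancy (γ : Measure (Config Ω × Config Ω)) [IsProbabilityMeasure γ] (φ : Reparam)
    {S : Set (Config Ω × Config Ω)} {X : Set unitInterval}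
    (hS : MeasurableSet S) (hX : MeasurableSet X) (ω : Ω) :
    |∫ p in S, Config.defect φ X ω p ∂γ| ≤ discrepancy γ φ := by
  refine le_ciSup (f := fun q : {S : Set (Config Ω × Config Ω) // MeasurableSet S} ×
    {X : Set unitInterval // MeasurableSet X} × Ω =>
    |∫ p in q.1.1, Config.defect φ q.2.1.1 q.2.2 p ∂γ|) ?_ (⟨S, hS⟩, ⟨X, hX⟩, ω)
  refine ⟨1, ?_⟩
  rintro _ ⟨q, rfl⟩
  exact CutKernel.abs_setIntegral_le (fun p => Config.abs_defect_le _ _ _ _) _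

theorem discrepancy_nonneg (γ : Measure (Config Ω × Config Ω)) (φ : Reparam) :
    0 ≤ discrepancy γ φ :=
  Real.iSup_nonneg fun _ => abs_nonneg _

theorem discrepancy_le (γ : Measure (Config Ω × Config Ω)) (φ : Reparam) {c : ℝ} (hc : 0 ≤ c)
    (H : ∀ (S : Set (Config Ω × Config Ω)) (X : Set unitInterval), MeasurableSet S →
      MeasurableSet X → ∀ ω, |∫ p in S, Config.defect φ X ω p ∂γ| ≤ c) :
    discrepancy γ φ ≤ c :=
  Real.iSup_le (fun q => H _ _ q.1.2 q.2.1.2 _) hc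

theorem _root_.CutMetric.Coupling.isProb {μ ν : ConfigLaw Ω} (γ : Coupling μ ν) :
    IsProbabilityMeasure γ.1 := by
  constructor
  have h := measure_univ (μ := μ.measure)
  rwa [← γ.2.1, Measure.map_apply measurable_fst MeasurableSet.univ, Set.preimage_univ] at h

instance (μ ν : ConfigLaw Ω) : Nonempty (Coupling μ ν) := by
  refine ⟨⟨μ.measure.prod ν.measure, ?_, ?_⟩⟩
  · exact Measure.fst_prod
  · exact Measure.snd_prod

variable [Nonempty Ω]

theorem integrable_defect (γ : Measure (Config Ω × Config Ω)) [IsProbabilityMeasure γ]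
    (φ : Reparam) (X : Set unitInterval) (ω : Ω) : Integrable (Config.defect φ X ω) γ :=
  Integrable.of_bound (Config.measurable_defect φ X ω).aestronglyMeasurable 1
    (.of_forall fun p => Config.abs_defect_le φ X ω p)

/-- The diagonal coupling of a law with itself. -/
def diagCoupling (μ : ConfigLaw Ω) : Coupling μ μ := by
  refine ⟨μ.measure.map fun σ => (σ, σ), ?_, ?_⟩
  · rw [Measure.map_map measurable_fst (by fun_prop)]
    exact Measure.map_id
  · rw [Measure.map_map measurable_snd (by fun_prop)]
    exact Measure.map_id

theorem discrepancy_diag (μ : ConfigLaw Ω) :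
    discrepancy (diagCoupling μ).1 Reparam.refl = 0 := by
  refine le_antisymm (discrepancy_le _ _ le_rfl fun S X hS _ ω => ?_) (discrepancy_nonneg _ _)
  have hm : Measurable fun σ : Config Ω => (σ, σ) := measurable_id.prodMk measurable_id
  change |∫ p in S, Config.defect Reparam.refl X ω p ∂(μ.measure.map fun σ => (σ, σ))| ≤ 0
  rw [setIntegral_map hS (Config.measurable_defect _ X ω).aestronglyMeasurable hm.aemeasurable]
  simp only [Config.defect_refl, integral_zero, abs_zero, le_refl]

/-- The coupling with the two components exchanged. -/
def swapCoupling {μ ν : ConfigLaw Ω} (γ : Coupling μ ν) : Coupling ν μ := by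
  refine ⟨γ.1.map Prod.swap, ?_, ?_⟩
  · rw [Measure.map_map measurable_fst measurable_swap]
    exact γ.2.2
  · rw [Measure.map_map measurable_snd measurable_swap]
    exact γ.2.1

theorem discrepancy_swap_le {μ ν : ConfigLaw Ω} (γ : Coupling μ ν) (φ : Reparam) :
    discrepancy (swapCoupling γ).1 φ.symm ≤ discrepancy γ.1 φ := by
  have := γ.isProb
  refine discrepancy_le _ _ (discrepancy_nonneg _ _) fun S X hS hX ω => ?_
  change |∫ p in S, Config.defect φ.symm X ω p ∂(γ.1.map Prod.swap)| ≤ _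
  rw [setIntegral_map hS (Config.measurable_defect _ X ω).aestronglyMeasurable
    measurable_swap.aemeasurable]
  simp only [Config.defect_symm, integral_neg, abs_neg]
  exact le_discrepancy γ.1 φ (measurable_swap hS) (φ.symm.measurableSet_image hX) ω

/-- Gluing two couplings along their common marginal. -/
theorem exists_glue {μ ν ξ : ConfigLaw Ω} (γ : Coupling μ ν) (δ : Coupling ν ξ) :
    ∃ η : Measure ((Config Ω × Config Ω) × Config Ω), IsProbabilityMeasure η ∧
      η.map Prod.fst = γ.1 ∧ η.map (fun t => (t.1.2, t.2)) = δ.1 := by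
  have := γ.isProb
  have := δ.isProb
  have hsnd : Measurable (Prod.snd : Config Ω × Config Ω → Config Ω) := measurable_snd
  let κ := δ.1.condKernel.comap (Prod.snd : Config Ω × Config Ω → Config Ω) hsnd
  refine ⟨γ.1.compProd κ, inferInstance, Measure.fst_compProd γ.1 κ, ?_⟩
  have hf : Measurable fun t : (Config Ω × Config Ω) × Config Ω => (t.1.2, t.2) := by fun_prop
  ext S hS
  have hδ : δ.1.fst = γ.1.map Prod.snd := δ.2.1.trans γ.2.2.symm
  conv_rhs => rw [← δ.1.disintegrate δ.1.condKernel, hδ]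
  rw [Measure.map_apply hf hS, Measure.compProd_apply (hf hS)]
  have : IsProbabilityMeasure (γ.1.map Prod.snd) :=
    Measure.isProbabilityMeasure_map measurable_snd.aemeasurable
  rw [Measure.compProd_apply hS, lintegral_map
    (ProbabilityTheory.Kernel.measurable_kernel_prodMk_left hS) measurable_snd]
  rfl

theorem abs_setIntegral_comp_le (γ : Measure (Config Ω × Config Ω)) [IsProbabilityMeasure γ]
    (φ : Reparam) {X : Set unitInterval} (hX : MeasurableSet X) (ω : Ω) {α : Type*}
    [MeasurableSpace α] {η : Measure α} {f : α → Config Ω × Config Ω} (hf : Measurable f)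
    (hη : η.map f = γ) (T : Set α) :
    |∫ t in T, Config.defect φ X ω (f t) ∂η| ≤ discrepancy γ φ := by
  have hd := Config.measurable_defect (Ω := Ω) φ X ω
  have hi : Integrable (fun t => Config.defect φ X ω (f t)) η := by
    have := integrable_defect γ φ X ω
    rw [← hη] at this
    exact this.comp_measurable hf
  have bound : ∀ g : Config Ω × Config Ω → ℝ, Measurable g → Integrable (fun t => g (f t)) η →
      ∫ t in T, g (f t) ∂η ≤ ∫ p in {p | 0 < g p}, g p ∂γ := by
    intro g hg hgi
    have hS : MeasurableSet {p | 0 < g p} := measurableSet_lt measurable_const hg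
    calc ∫ t in T, g (f t) ∂η ≤ ∫ t in T, max (g (f t)) 0 ∂η :=
          integral_mono hgi.integrableOn hgi.pos_part.integrableOn fun t => le_max_left _ _
      _ ≤ ∫ t, max (g (f t)) 0 ∂η :=
          setIntegral_le_integral hgi.pos_part (.of_forall fun t => le_max_right _ _)
      _ = ∫ p, max (g p) 0 ∂γ := by
          rw [← hη, integral_map hf.aemeasurable
            (hg.max measurable_const).aestronglyMeasurable]
      _ = ∫ p in {p | 0 < g p}, g p ∂γ := by
          rw [← integral_indicator hS]
          refine integral_congr_ae (.of_forall fun p => ?_)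
          by_cases h : 0 < g p
          · rw [Set.indicator_of_mem (show p ∈ {p | 0 < g p} from h)]
            exact max_eq_left h.le
          · rw [Set.indicator_of_notMem (show p ∉ {p | 0 < g p} from h)]
            exact max_eq_right (not_lt.1 h)
  have b1 := bound _ hd hi
  have b2 := bound _ hd.neg hi.neg
  have c1 := le_discrepancy γ φ (S := {p | 0 < Config.defect φ X ω p})
    (measurableSet_lt measurable_const hd) hX ω
  have c2 := le_discrepancy γ φ
    (S := {p | 0 < (-Config.defect φ X ω) p}) (measurableSet_lt measurable_const hd.neg) hX ω
  simp only [Pi.neg_apply, integral_neg] at b2 c2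
  exact abs_le.2 ⟨by linarith [(abs_le.1 c2).1], by linarith [(abs_le.1 c1).2]⟩

theorem exists_discrepancy_trans_le {μ ν ξ : ConfigLaw Ω} (γ : Coupling μ ν) (δ : Coupling ν ξ)
    (φ ψ : Reparam) : ∃ ε : Coupling μ ξ,
      discrepancy ε.1 (φ.trans ψ) ≤ discrepancy γ.1 φ + discrepancy δ.1 ψ := by
  have := γ.isProb
  have := δ.isProb
  obtain ⟨η, hη, h1, h2⟩ := exists_glue γ δ
  have m1 : Measurable fun t : (Config Ω × Config Ω) × Config Ω => (t.1.1, t.2) := by fun_prop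
  have m2 : Measurable fun t : (Config Ω × Config Ω) × Config Ω => (t.1.2, t.2) := by fun_prop
  refine ⟨⟨η.map fun t => (t.1.1, t.2), ?_, ?_⟩, ?_⟩
  · rw [Measure.map_map measurable_fst m1, ← γ.2.1, ← h1,
      Measure.map_map measurable_fst measurable_fst]
    rfl
  · rw [Measure.map_map measurable_snd m1, ← δ.2.2, ← h2, Measure.map_map measurable_snd m2]
    rfl
  refine discrepancy_le _ _ (add_nonneg (discrepancy_nonneg _ _) (discrepancy_nonneg _ _))
    fun S X hS hX ω => ?_
  change |∫ p in S, Config.defect (φ.trans ψ) X ω p ∂(η.map fun t => (t.1.1, t.2))| ≤ _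
  rw [setIntegral_map hS (Config.measurable_defect _ X ω).aestronglyMeasurable m1.aemeasurable]
  have hsplit : ∀ t : (Config Ω × Config Ω) × Config Ω,
      Config.defect (φ.trans ψ) X ω (t.1.1, t.2) =
        Config.defect φ X ω t.1 + Config.defect ψ (φ '' X) ω (t.1.2, t.2) :=
    fun t => Config.defect_trans φ ψ X ω t.1.1 t.1.2 t.2
  simp only [hsplit]
  rw [integral_add]
  · exact (abs_add_le _ _).trans (add_le_add
      (abs_setIntegral_comp_le γ.1 φ hX ω measurable_fst h1 _)
      (abs_setIntegral_comp_le δ.1 ψ (φ.measurableSet_image hX) ω m2 h2 _))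
  · exact Integrable.of_bound
      ((Config.measurable_defect φ X ω).comp measurable_fst).aestronglyMeasurable 1
      (.of_forall fun t => Config.abs_defect_le φ X ω _)
  · exact Integrable.of_bound
      ((Config.measurable_defect ψ (φ '' X) ω).comp m2).aestronglyMeasurable 1
      (.of_forall fun t => Config.abs_defect_le ψ (φ '' X) ω _)

/-- The cut distance is a pseudometric on laws. -/
instance instPseudoMetricSpace : PseudoMetricSpace (ConfigLaw Ω) where
  dist := cutDist
  dist_self μ := by
    refine le_antisymm ?_ (Real.iInf_nonneg fun _ => discrepancy_nonneg _ _)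
    rw [← discrepancy_diag μ]
    exact ciInf_le (f := fun p : Coupling μ μ × Reparam => discrepancy p.1.1 p.2)
      ⟨0, by rintro _ ⟨p, rfl⟩; exact discrepancy_nonneg _ _⟩ (diagCoupling μ, Reparam.refl)
  dist_comm μ ν := by
    refine le_antisymm ?_ ?_ <;>
    exact iInf_le_iInf_of_exists (fun _ => discrepancy_nonneg _ _) fun p =>
      ⟨(swapCoupling p.1, p.2.symm), discrepancy_swap_le _ _⟩
  dist_triangle μ ν ξ :=
    iInf_le_iInf_add_iInf (fun _ => discrepancy_nonneg _ _) fun p q =>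
      let ⟨ε, hε⟩ := exists_discrepancy_trans_le p.1 q.1 p.2 q.2
      ⟨(ε, p.2.trans q.2), hε⟩

theorem dist_eq_cutDist (μ ν : ConfigLaw Ω) : dist μ ν = cutDist μ ν := rfl

end ConfigLaw

/-! ### The law represented by a kernel, and the two metric spaces -/

namespace CutKernel

variable {Ω : Type*} [Fintype Ω]

/-- The configuration `κ_s : x ↦ κ_{s,x}`. -/
def slice (κ : CutKernel Ω) (s : unitInterval) : Config Ω :=
  Config.mk (κ.val s) (κ.measurable_val.comp measurable_prodMk_left)

theorem measurable_slice [Nonempty Ω] (κ : CutKernel Ω) : Measurable κ.slice := by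
  have hd : ∀ σ : Config Ω, Measurable fun s => dist (κ.slice s) σ := by
    intro σ
    have h : ∀ s, dist (κ.slice s) σ = ∑ ω, ∫ x, |κ.prob s x ω - σ.prob x ω| := by
      intro s
      refine Finset.sum_congr rfl fun ω _ => integral_congr_ae ?_
      filter_upwards [Config.prob_mk (κ.val s) (κ.measurable_val.comp measurable_prodMk_left)]
        with x hx
      exact congrArg (fun r => |r - σ.prob x ω|) (hx ω)
    simp only [h]
    refine Finset.measurable_sum _ fun ω _ => ?_
    have hm : Measurable fun p : unitInterval × unitInterval =>
        |κ.prob p.1 p.2 ω - σ.prob p.2 ω| :=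
      ((κ.measurable_prob ω).sub ((σ.measurable_prob ω).comp measurable_snd)).abs
    exact (hm.stronglyMeasurable.integral_prod_right (ν := volume)).measurable
  obtain ⟨D, hDc, hDd⟩ := TopologicalSpace.exists_countable_dense (Config Ω)
  refine measurable_of_isOpen fun U hU => ?_
  have hU' : U = ⋃ σ ∈ D, ⋃ r : {r : ℚ // Metric.ball σ (r : ℝ) ⊆ U},
      Metric.ball σ (r.1 : ℝ) := by
    refine Set.Subset.antisymm (fun τ hτ => ?_) ?_
    · obtain ⟨ε, hε, hb⟩ := Metric.isOpen_iff.1 hU τ hτ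
      obtain ⟨q, hq0, hq⟩ := exists_rat_btwn (half_pos hε)
      obtain ⟨σ, hσD, hσ⟩ := hDd.exists_dist_lt τ hq0
      simp only [Set.mem_iUnion]
      refine ⟨σ, hσD, ⟨q, fun ρ hρ => hb ?_⟩, Metric.mem_ball.2 hσ⟩
      have h1 := dist_triangle ρ σ τ
      rw [dist_comm σ τ] at h1
      exact Metric.mem_ball.2 (by linarith [Metric.mem_ball.1 hρ])
    · exact Set.iUnion₂_subset fun σ _ => Set.iUnion_subset fun r => r.2
  rw [hU']
  simp only [Set.preimage_iUnion]
  exact MeasurableSet.biUnion hDc fun σ _ => MeasurableSet.iUnion fun r =>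
    measurableSet_lt (hd σ) measurable_const

/-- The law `μ^κ`: the distribution of `κ_s` for `s` uniformly distributed on `[0,1]`.
(Another representative of `κ` changes `κ_s` only for `s` in a null set, hence not the law.) -/
def law [Nonempty Ω] (κ : CutKernel Ω) : ConfigLaw Ω where
  measure := (volume : Measure unitInterval).map κ.slice
  isProbabilityMeasure := Measure.isProbabilityMeasure_map κ.measurable_slice.aemeasurable

end CutKernel

/-- The metric space of kernels: kernels of cut distance zero are identified. -/
abbrev KernelSpace (Ω : Type*) [Fintype Ω] : Type _ := SeparationQuotient (CutKernel Ω)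

/-- The metric space of `Ω`-laws: laws of cut distance zero are identified. -/
abbrev LawSpace (Ω : Type*) [Fintype Ω] [Nonempty Ω] : Type _ := SeparationQuotient (ConfigLaw Ω)

/-- The class of a kernel. -/
def KernelSpace.mk {Ω : Type*} [Fintype Ω] (κ : CutKernel Ω) : KernelSpace Ω :=
  SeparationQuotient.mk κ

/-- The class of a law. -/
def LawSpace.mk {Ω : Type*} [Fintype Ω] [Nonempty Ω] (μ : ConfigLaw Ω) : LawSpace Ω :=
  SeparationQuotient.mk μ

theorem KernelSpace.mk_eq_mk_iff {Ω : Type*} [Fintype Ω] (κ κ' : CutKernel Ω) :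
    KernelSpace.mk κ = KernelSpace.mk κ' ↔ CutKernel.cutDist κ κ' = 0 :=
  SeparationQuotient.mk_eq_mk.trans Metric.inseparable_iff

theorem KernelSpace.dist_mk {Ω : Type*} [Fintype Ω] (κ κ' : CutKernel Ω) :
    dist (KernelSpace.mk κ) (KernelSpace.mk κ') = CutKernel.cutDist κ κ' := rfl

theorem LawSpace.mk_eq_mk_iff {Ω : Type*} [Fintype Ω] [Nonempty Ω] (μ ν : ConfigLaw Ω) :
    LawSpace.mk μ = LawSpace.mk ν ↔ ConfigLaw.cutDist μ ν = 0 :=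
  SeparationQuotient.mk_eq_mk.trans Metric.inseparable_iff

theorem LawSpace.dist_mk {Ω : Type*} [Fintype Ω] [Nonempty Ω] (μ ν : ConfigLaw Ω) :
    dist (LawSpace.mk μ) (LawSpace.mk ν) = ConfigLaw.cutDist μ ν := rfl

end

end CutMetric

namespace CutMetric

/-! ### Isomorphisms of probability spaces -/

/-! The cut distances of `κ`, `κ'` and of their laws agree exactly; this gives well-definedness,
isometry and injectivity at once. Surjectivity holds already before passing to the quotients.

An alignment `(φ, ψ)` of two kernels yields the coupling of their laws under which the pair is
`(κ_s, κ'_{φ(s)})` for uniform `s`, with the same `ψ`. Sets of pairs pull back to sets of times, so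
the discrepancy does not grow (`cutDist_law_le`).

Conversely, a coupling `γ` is the distribution of some `p : [0,1] → Config Ω × Config Ω`. Each
component of `p` has the same law as the slices of the corresponding kernel, but equality in law
only gives a reparametrisation up to an error: quantize the Polish space `Config Ω` to countably
many points, and use that two equally distributed maps `[0,1] → ℕ` differ by a measure-preserving
bijection (`exists_reparam_comp_ae_eq`). The discrepancy moves by at most `ε` under this
replacement, and the infimum absorbs `ε` (`cutDist_le_law`).

For surjectivity (`exists_law_eq`), write a law as the distribution of a map `h : [0,1] → Config Ω`
and choose representatives of all configurations in a jointly measurable way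
(`Config.exists_measurable_eval`), so that `h` becomes a kernel. -/

/-- Transported to `ℝ × ℝ`, the space splits into uncountably many uncountable vertical lines, of
which only countably many can be charged. Such a null set leaves room to repair an almost-bijection.
-/
theorem exists_measurableSet_null_not_countable {X : Type*} [MeasurableSpace X]
    [StandardBorelSpace X] (hX : ¬ Countable X) (μ : Measure X) [SFinite μ] :
    ∃ N : Set X, MeasurableSet N ∧ μ N = 0 ∧ ¬ N.Countable := by
  have hR : ¬ Countable ℝ := not_countable_iff.2 inferInstance
  have hRR : ¬ Countable (ℝ × ℝ) := not_countable_iff.2 inferInstance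
  let e : X ≃ᵐ ℝ × ℝ := PolishSpace.measurableEquivOfNotCountable hX hRR
  let A : ℝ → Set X := fun r => (fun x => (e x).1) ⁻¹' {r}
  have hm : Measurable fun x => (e x).1 := measurable_fst.comp e.measurable
  have hA : ∀ r, MeasurableSet (A r) := fun r => hm (measurableSet_singleton r)
  have hd : Pairwise (Function.onFun Disjoint A) := fun r s hrs =>
    Disjoint.preimage _ (Set.disjoint_singleton.2 hrs)
  have hc := Measure.countable_meas_pos_of_disjoint_iUnion (μ := μ) hA hd
  obtain ⟨r, hr⟩ : ∃ r, ¬ 0 < μ (A r) := by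
    by_contra! h
    exact Set.not_countable_univ (hc.mono fun r _ => h r)
  refine ⟨A r, hA r, by simpa using hr, fun hcount => ?_⟩
  refine Set.not_countable_univ (α := ℝ) ?_
  have : Set.MapsTo (fun t : ℝ => e.symm (r, t)) Set.univ (A r) := fun t _ => by simp [A]
  refine this.countable_of_injOn (fun s _ t _ hst => ?_) hcount
  exact (Prod.ext_iff.1 (e.symm.injective hst)).2

/-- A measure preserving map between standard Borel spaces that is injective on a set of full
measure agrees almost everywhere with a measurable equivalence. -/
theorem exists_measurableEquiv_ae_eq {X Y : Type*} [MeasurableSpace X] [StandardBorelSpace X]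
    [MeasurableSpace Y] [StandardBorelSpace Y] (hX : ¬ Countable X) (hY : ¬ Countable Y)
    {μ : Measure X} {ν : Measure Y} [SFinite μ] [SFinite ν] {T : X → Y}
    (hT : MeasurePreserving T μ ν) {A : Set X} (hA : MeasurableSet A) (hAμ : μ Aᶜ = 0)
    (hinj : Set.InjOn T A) :
    ∃ e : X ≃ᵐ Y, MeasurePreserving e μ ν ∧ e =ᵐ[μ] T := by
  classical
  obtain ⟨M, hM, hM0, hMc⟩ := exists_measurableSet_null_not_countable hX μ
  obtain ⟨N, hN, hN0, hNc⟩ := exists_measurableSet_null_not_countable hY ν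
  -- Discarding `M` and `T ⁻¹' N` costs nothing in measure and makes the complements of `B` and of
  -- `T '' B` both uncountable, so that the leftovers are Borel isomorphic.
  let B : Set X := A \ (M ∪ T ⁻¹' N)
  have hB : MeasurableSet B := hA.diff (hM.union (hT.measurable hN))
  have hBinj : Set.InjOn T B := hinj.mono Set.sdiff_subset
  have hC : MeasurableSet (T '' B) := hB.image_of_measurable_injOn hT.measurable hBinj
  have hBc : ¬ Countable (Bᶜ : Set X) := fun h =>
    hMc ((Set.countable_coe_iff.1 h).mono fun x hx (hxB : x ∈ B) => hxB.2 (Or.inl hx))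
  have hCc : ¬ Countable ((T '' B)ᶜ : Set Y) := fun h =>
    hNc ((Set.countable_coe_iff.1 h).mono fun y hy => by
      rintro ⟨x, hxB, rfl⟩
      exact hxB.2 (Or.inr hy))
  have hBae : ∀ᵐ x ∂μ, x ∈ B := by
    have h1 : ∀ᵐ x ∂μ, x ∈ A := hAμ
    have h2 : ∀ᵐ x ∂μ, x ∉ M := measure_eq_zero_iff_ae_notMem.1 hM0
    have h3 : ∀ᵐ x ∂μ, x ∉ T ⁻¹' N := measure_eq_zero_iff_ae_notMem.1
      (by rw [hT.measure_preimage hN.nullMeasurableSet, hN0])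
    filter_upwards [h1, h2, h3] with x h1 h2 h3 using ⟨h1, fun h => h.elim h2 h3⟩
  have : StandardBorelSpace (Bᶜ : Set X) := hB.compl.standardBorel
  have : StandardBorelSpace ((T '' B)ᶜ : Set Y) := hC.compl.standardBorel
  let e₂ : (Bᶜ : Set X) ≃ᵐ ((T '' B)ᶜ : Set Y) := PolishSpace.measurableEquivOfNotCountable hBc hCc
  let f : X → Y := fun x => if h : x ∈ B then T x else e₂ ⟨x, h⟩
  have hfB : ∀ x ∈ B, f x = T x := fun x h => dif_pos h
  have hfBc : ∀ x (h : x ∉ B), f x = e₂ ⟨x, h⟩ := fun x h => dif_neg h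
  have hfm : Measurable f :=
    Measurable.dite (s := B) (f := fun x : B => T x) (g := fun x : (Bᶜ : Set X) => (e₂ x : Y))
      (hT.measurable.comp measurable_subtype_coe) (measurable_subtype_coe.comp e₂.measurable) hB
  have hfi : Function.Injective f := by
    intro x y hxy
    by_cases hx : x ∈ B <;> by_cases hy : y ∈ B
    · rw [hfB x hx, hfB y hy] at hxy
      exact hBinj hx hy hxy
    · rw [hfB x hx, hfBc y hy] at hxy
      exact absurd ⟨x, hx, hxy⟩ (e₂ ⟨y, hy⟩).2
    · rw [hfBc x hx, hfB y hy] at hxy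
      exact absurd ⟨y, hy, hxy.symm⟩ (e₂ ⟨x, hx⟩).2
    · rw [hfBc x hx, hfBc y hy] at hxy
      exact congrArg Subtype.val (e₂.injective (Subtype.ext hxy))
  have hfs : Function.Surjective f := by
    intro y
    by_cases hy : y ∈ T '' B
    · obtain ⟨x, hx, rfl⟩ := hy
      exact ⟨x, hfB x hx⟩
    · refine ⟨e₂.symm ⟨y, hy⟩, ?_⟩
      rw [hfBc _ (e₂.symm ⟨y, hy⟩).2]
      simp
  let e : X ≃ᵐ Y :=
    { toEquiv := Equiv.ofBijective f ⟨hfi, hfs⟩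
      measurable_toFun := hfm
      measurable_invFun := by
        intro s hs
        rw [← Equiv.image_eq_preimage_symm]
        exact (hfm.measurableEmbedding hfi).measurableSet_image.2 hs }
  have he : e =ᵐ[μ] T := by
    filter_upwards [hBae] with x hx using hfB x hx
  exact ⟨e, ⟨e.measurable, (Measure.map_congr he).trans hT.map_eq⟩, he⟩

/-- The quantile function of an atomless distribution on the unit interval. -/
theorem exists_strictMono_map_eq (μ : Measure unitInterval) [IsProbabilityMeasure μ]
    [NullSingletonClass μ] :
    ∃ f : unitInterval → unitInterval, StrictMono f ∧ MeasurePreserving f volume μ := by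
  let f : unitInterval → unitInterval := fun u => sSup {x | μ.real (Set.Iic x) < u}
  have hF : Monotone fun x => μ.real (Set.Iic x) := fun x y hxy =>
    measureReal_mono (Set.Iic_subset_Iic.2 hxy)
  have hmono : Monotone f := fun u v huv =>
    sSup_le_sSup fun x hx => lt_of_lt_of_le (show μ.real (Set.Iic x) < (u : ℝ) from hx) huv
  have hm : Measurable f := hmono.measurable
  have hmap : (volume : Measure unitInterval).map f = μ := by
    refine Measure.ext_of_Iic _ _ fun x => ?_
    have hI : μ.real (Set.Iic x) ∈ unitInterval := ⟨measureReal_nonneg, measureReal_le_one⟩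
    rw [Measure.map_apply hm measurableSet_Iic, ← ofReal_measureReal (measure_ne_top μ _),
      ← unitInterval.volume_Iic ⟨_, hI⟩]
    congr 1
    ext u
    -- The Galois connection between the quantile function and the distribution function.
    change f u ≤ x ↔ (u : ℝ) ≤ μ.real (Set.Iic x)
    constructor
    · intro h
      by_contra! hlt
      -- Right-continuity of the distribution function at `x` will give a point above `x` whose
      -- value is still below `u`; at `x = 1` there is no such point, but there the value is `1`.
      obtain rfl | hx := eq_or_lt_of_le (show x ≤ 1 from unitInterval.le_one')
      · have : Set.Iic (1 : unitInterval) = Set.univ :=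
          Set.eq_univ_of_forall fun y => unitInterval.le_one'
        rw [this, probReal_univ] at hlt
        exact absurd u.2.2 (not_le.2 hlt)
      obtain ⟨y, hy, hxy, hy'⟩ : ∃ y : ℕ → unitInterval, StrictAnti y ∧ (∀ n, x < y n) ∧
          Filter.Tendsto y Filter.atTop (nhds x) := by
        obtain ⟨y, h1, h2, h3⟩ := exists_seq_strictAnti_tendsto' hx
        exact ⟨y, h1, fun n => (h2 n).1, h3⟩
      have hint : ⋂ n, Set.Iic (y n) = Set.Iic x := by
        ext z
        simp only [Set.mem_iInter, Set.mem_Iic]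
        exact ⟨fun h => ge_of_tendsto' hy' h, fun h n => h.trans (hxy n).le⟩
      have hlim := tendsto_measure_iInter_atTop (μ := μ) (s := fun n => Set.Iic (y n))
        (fun n => measurableSet_Iic.nullMeasurableSet)
        (fun m n hmn => Set.Iic_subset_Iic.2 (hy.antitone hmn)) ⟨0, measure_ne_top _ _⟩
      rw [hint] at hlim
      have hlim' := (ENNReal.tendsto_toReal (measure_ne_top μ _)).comp hlim
      obtain ⟨n, hn⟩ := (hlim'.eventually_lt_const hlt).exists
      exact absurd ((le_sSup (show y n ∈ {x | μ.real (Set.Iic x) < u} from hn)).trans h)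
        (not_le.2 (hxy n))
    · intro h
      refine sSup_le fun c hc => ?_
      by_contra! hlt
      exact absurd (lt_of_lt_of_le (show μ.real (Set.Iic c) < (u : ℝ) from hc) h) (not_lt.2 (hF hlt.le))
  refine ⟨f, hmono.strictMono_of_injective fun u v huv => ?_, hm, hmap⟩
  by_contra hne
  wlog hlt : u < v generalizing u v
  · exact this v u huv.symm (Ne.symm hne) (lt_of_le_of_ne (not_lt.1 hlt) (Ne.symm hne))
  -- If `f u = f v`, monotonicity makes `f` constant on `[u, v]`, so `f u` would be an atom of mass
  -- at least `v - u`.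
  have h1 : Set.Icc u v ⊆ f ⁻¹' {f u} := fun w hw =>
    le_antisymm ((hmono hw.2).trans huv.ge) (hmono hw.1)
  have h2 := measure_mono (μ := volume) h1
  rw [← Measure.map_apply hm (measurableSet_singleton _), hmap, measure_singleton,
    unitInterval.volume_Icc] at h2
  have : (0 : ℝ) < v - u := sub_pos.2 hlt
  exact absurd h2 (not_le.2 (by simpa using hlt))

/-- A measurable map `a` from the unit interval to `ℕ` is, up to a measure preserving equivalence,
the projection of a product space onto its first factor. -/
theorem exists_measurableEquiv_fst {a : unitInterval → ℕ} (ha : Measurable a) :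
    ∃ e : ℕ × unitInterval ≃ᵐ unitInterval,
      MeasurePreserving e (((volume : Measure unitInterval).map a).prod volume) volume ∧
      ∀ᵐ q ∂((volume : Measure unitInterval).map a).prod volume, a (e q) = q.1 := by
  let U : ℕ → Set unitInterval := fun j => a ⁻¹' {j}
  have hU : ∀ j, MeasurableSet (U j) := fun j => ha (measurableSet_singleton j)
  set p : Measure ℕ := (volume : Measure unitInterval).map a with hp
  have : IsProbabilityMeasure p := Measure.isProbabilityMeasure_map ha.aemeasurable
  have hpU : ∀ j, p {j} = volume (U j) := fun j =>
    Measure.map_apply ha (measurableSet_singleton j)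
  -- On the cell `U j`, `f` is the quantile function of Lebesgue measure conditioned on that cell.
  -- Multiplying by `p {j}` makes the identity meaningful for null cells too, where any injective
  -- map serves.
  have key : ∀ j, ∃ f : unitInterval → unitInterval, Function.Injective f ∧ Measurable f ∧
      ∀ S, MeasurableSet S → volume (f ⁻¹' S) * p {j} = volume (S ∩ U j) := by
    intro j
    by_cases hj : volume (U j) = 0
    · refine ⟨id, Function.injective_id, measurable_id, fun S _ => ?_⟩
      rw [hpU, hj, mul_zero, measure_mono_null Set.inter_subset_right hj]
    · let μ : Measure unitInterval := ProbabilityTheory.cond volume (U j)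
      have : IsProbabilityMeasure μ := ProbabilityTheory.cond_isProbabilityMeasure hj
      have : NullSingletonClass μ := ⟨fun x =>
        ProbabilityTheory.cond_absolutelyContinuous (measure_singleton x)⟩
      obtain ⟨f, hf, hfm⟩ := exists_strictMono_map_eq μ
      refine ⟨f, hf.injective, hfm.measurable, fun S hS => ?_⟩
      rw [hfm.measure_preimage hS.nullMeasurableSet, hpU, Set.inter_comm]
      exact ProbabilityTheory.cond_mul_eq_inter (hU j) S volume
  choose f hfi hfm hfS using key
  let T : ℕ × unitInterval → unitInterval := fun q => f q.1 q.2
  have hTm : Measurable T := measurable_from_prod_countable_right hfm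
  have hprod : ∀ S, MeasurableSet S → p.prod (volume : Measure unitInterval) S =
      ∑' j, volume (Prod.mk j ⁻¹' S) * p {j} := fun S hS => by
    rw [Measure.prod_apply hS, lintegral_countable']
  have hT : MeasurePreserving T (p.prod volume) volume := by
    refine ⟨hTm, Measure.ext fun S hS => ?_⟩
    rw [Measure.map_apply hTm hS, hprod _ (hTm hS)]
    have h1 : ∀ j, volume (Prod.mk j ⁻¹' (T ⁻¹' S)) * p {j} = volume (S ∩ U j) :=
      fun j => hfS j S hS
    simp only [h1]
    rw [← measure_iUnion _ fun j => hS.inter (hU j), ← Set.inter_iUnion]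
    · congr 1
      refine Set.inter_eq_left.2 fun x _ => Set.mem_iUnion.2 ⟨a x, rfl⟩
    · intro i j hij
      exact ((Set.disjoint_singleton.2 hij).preimage a).mono Set.inter_subset_right
        Set.inter_subset_right
  -- The points sent into their own cell. On `A` the value of `T` determines the first coordinate,
  -- hence, by injectivity of each `f j`, also the second.
  let A : Set (ℕ × unitInterval) := {q | a (T q) = q.1}
  have hA : MeasurableSet A := measurableSet_eq_fun (ha.comp hTm) measurable_fst
  have hA0 : p.prod (volume : Measure unitInterval) Aᶜ = 0 := by
    rw [hprod _ hA.compl, ENNReal.tsum_eq_zero]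
    intro j
    have : Prod.mk j ⁻¹' Aᶜ = f j ⁻¹' (U j)ᶜ := rfl
    rw [this, hfS j _ (hU j).compl, Set.compl_inter_self, measure_empty]
  have hinj : Set.InjOn T A := by
    rintro ⟨i, u⟩ hi ⟨j, v⟩ hj h
    obtain rfl : i = j := by
      rw [← show a (T (i, u)) = i from hi, ← show a (T (j, v)) = j from hj, h]
    exact congrArg (Prod.mk i) (hfi i h)
  have hI : ¬ Countable unitInterval := fun h => by
    have := (Set.countable_univ (α := unitInterval)).measure_zero volume
    simp at this
  have hNI : ¬ Countable (ℕ × unitInterval) := fun h =>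
    hI ((Prod.mk_right_injective 0).countable (f := fun u : unitInterval => ((0 : ℕ), u)))
  obtain ⟨e, he, heT⟩ := exists_measurableEquiv_ae_eq hNI hI hT hA hA0 hinj
  refine ⟨e, he, ?_⟩
  have hA' : ∀ᵐ q ∂p.prod (volume : Measure unitInterval), q ∈ A := hA0
  filter_upwards [heT, hA'] with q h1 h2
  rw [h1]
  exact h2

/-- Equally distributed maps from the unit interval to `ℕ` differ by a reparametrisation. -/
theorem exists_reparam_comp_ae_eq {a b : unitInterval → ℕ} (ha : Measurable a)
    (hb : Measurable b) (hab : (volume : Measure unitInterval).map a = volume.map b) :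
    ∃ φ : Reparam, ∀ᵐ t, b (φ t) = a t := by
  obtain ⟨e, he, hae⟩ := exists_measurableEquiv_fst ha
  obtain ⟨e', he', hbe⟩ := exists_measurableEquiv_fst hb
  -- Both maps now have the same model, the projection of one product space, and `e' ∘ e⁻¹` matches
  -- them.
  rw [← hab] at he' hbe
  refine ⟨⟨e.symm.trans e', he'.comp (he.symm e)⟩, ?_⟩
  filter_upwards [(he.symm e).quasiMeasurePreserving.ae (hae.and hbe)] with t ht
  rw [e.apply_symm_apply] at ht
  exact ht.2.trans ht.1.symm

/-! ### The cut distance of kernels equals the cut distance of their laws -/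

section Config

variable {Ω : Type*} [Fintype Ω]

theorem Config.abs_setIntegral_sub_le (σ τ : Config Ω) (X : Set unitInterval) (ω : Ω) :
    |(∫ x in X, σ.prob x ω) - ∫ x in X, τ.prob x ω| ≤ dist σ τ := by
  rw [← integral_sub (σ.integrable_prob ω).integrableOn (τ.integrable_prob ω).integrableOn,
    Config.dist_def]
  have hi : Integrable fun x => |σ.prob x ω - τ.prob x ω| :=
    ((σ.integrable_prob ω).sub (τ.integrable_prob ω)).abs
  calc |∫ x in X, (σ.prob x ω - τ.prob x ω)| ≤ ∫ x in X, |σ.prob x ω - τ.prob x ω| :=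
        abs_integral_le_integral_abs
    _ ≤ ∫ x, |σ.prob x ω - τ.prob x ω| :=
        setIntegral_le_integral hi (.of_forall fun _ => abs_nonneg _)
    _ ≤ _ := Finset.single_le_sum (f := fun ω => ∫ x, |σ.prob x ω - τ.prob x ω|)
        (fun _ _ => integral_nonneg fun _ => abs_nonneg _) (Finset.mem_univ ω)

/-- By `Config.defect_eq` the defect is a difference of integrals over `X` and `φ '' X`, each
1-Lipschitz for `D₁`. This controls the cost of replacing configurations by approximations. -/
theorem Config.abs_defect_sub_le (φ : Reparam) (X : Set unitInterval) (ω : Ω)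
    (p q : Config Ω × Config Ω) :
    |Config.defect φ X ω p - Config.defect φ X ω q| ≤ dist p.1 q.1 + dist p.2 q.2 := by
  rw [Config.defect_eq, Config.defect_eq, sub_sub_sub_comm]
  exact (abs_sub _ _).trans (add_le_add (Config.abs_setIntegral_sub_le _ _ _ _)
    (Config.abs_setIntegral_sub_le _ _ _ _))

/-- A separable metric space can be quantized by countably many of its points. -/
theorem exists_measurable_quantizer {E : Type*} [MetricSpace E] [MeasurableSpace E]
    [BorelSpace E] [TopologicalSpace.SeparableSpace E] [Nonempty E] {ε : ℝ} (hε : 0 < ε) :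
    ∃ (a : E → ℕ) (d : ℕ → E), Measurable a ∧ ∀ x, dist x (d (a x)) < ε := by
  classical
  have h : ∀ x : E, ∃ n, dist x (TopologicalSpace.denseSeq E n) < ε := fun x =>
    (TopologicalSpace.denseRange_denseSeq E).exists_dist_lt x hε
  refine ⟨fun x => Nat.find (h x), TopologicalSpace.denseSeq E, ?_, fun x => Nat.find_spec (h x)⟩
  exact measurable_find h fun n => (Metric.isOpen_ball (x := TopologicalSpace.denseSeq E n)
    (ε := ε)).measurableSet

/-- The link between the two discrepancies. It holds for every `s` and `s'`, since a slice differs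
from the section defining it only on a null set of `x`, and `ψ` preserves null sets. -/
theorem CutKernel.defect_slice (κ κ' : CutKernel Ω) (ψ : Reparam) (X : Set unitInterval) (ω : Ω)
    (s s' : unitInterval) : Config.defect ψ X ω (κ.slice s, κ'.slice s') =
      ∫ x in X, (κ.prob s x ω - κ'.prob s' (ψ x) ω) := by
  refine integral_congr_ae (ae_restrict_of_ae ?_)
  filter_upwards [Config.prob_mk (κ.val s) (κ.measurable_val.comp measurable_prodMk_left),
    ψ.2.quasiMeasurePreserving.ae
      (Config.prob_mk (κ'.val s') (κ'.measurable_val.comp measurable_prodMk_left))] with x h1 h2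
  exact congrArg₂ (· - ·) (h1 ω) (h2 ω)

end Config

variable {Ω : Type*} [Fintype Ω] [Nonempty Ω]

/-- Use the coupling `s ↦ (κ_s, κ'_{φ(s)})`: a set of pairs is tested through its preimage, which is
among the sets tested for kernels. -/
theorem cutDist_law_le (κ κ' : CutKernel Ω) :
    ConfigLaw.cutDist κ.law κ'.law ≤ CutKernel.cutDist κ κ' := by
  refine iInf_le_iInf_of_exists (fun _ => ConfigLaw.discrepancy_nonneg _ _) fun ⟨φ, ψ⟩ => ?_
  let f : unitInterval → Config Ω × Config Ω := fun s => (κ.slice s, κ'.slice (φ s))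
  have hf : Measurable f := κ.measurable_slice.prodMk (κ'.measurable_slice.comp φ.measurable)
  refine ⟨(⟨(volume : Measure unitInterval).map f, ?_, ?_⟩, ψ), ?_⟩
  · rw [Measure.map_map measurable_fst hf]
    rfl
  · rw [Measure.map_map measurable_snd hf]
    have : Prod.snd ∘ f = κ'.slice ∘ φ := rfl
    rw [this, ← Measure.map_map κ'.measurable_slice φ.measurable, φ.2.map_eq]
    rfl
  · refine ConfigLaw.discrepancy_le _ _ (CutKernel.discrepancy_nonneg _ _ _ _)
      fun S X hS hX ω => ?_
    change |∫ p in S, Config.defect ψ X ω p ∂((volume : Measure unitInterval).map f)| ≤ _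
    rw [setIntegral_map hS (Config.measurable_defect _ X ω).aestronglyMeasurable hf.aemeasurable]
    simp only [f, CutKernel.defect_slice]
    exact CutKernel.le_discrepancy κ κ' φ ψ (hf hS) hX ω

/-- A map from the unit interval with the same law as `κ.slice` can be approximated by a
reparametrisation of `κ.slice`. -/
theorem exists_reparam_dist_slice_le (κ : CutKernel Ω) {p : unitInterval → Config Ω}
    (hp : Measurable p) (hlaw : (volume : Measure unitInterval).map p = κ.law.measure)
    {ε : ℝ} (hε : 0 < ε) : ∃ φ : Reparam, ∀ᵐ t, dist (κ.slice (φ t)) (p t) ≤ ε := by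
  obtain ⟨a, d, ha, hd⟩ := exists_measurable_quantizer (E := Config Ω) (half_pos hε)
  -- Only the quantized maps can be matched exactly: `p` may be injective while `κ.slice` is not.
  -- Points with a common label are within `ε / 2 + ε / 2`.
  obtain ⟨φ, hφ⟩ := exists_reparam_comp_ae_eq (ha.comp hp) (ha.comp κ.measurable_slice) (by
    rw [← Measure.map_map ha hp, hlaw, ← Measure.map_map ha κ.measurable_slice]
    rfl)
  refine ⟨φ, ?_⟩
  filter_upwards [hφ] with t ht
  have h1 := hd (κ.slice (φ t))
  have h2 := hd (p t)
  rw [show a (κ.slice (φ t)) = a (p t) from ht] at h1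
  linarith [dist_triangle_right (κ.slice (φ t)) (p t) (d (a (p t)))]

/-- Parametrise the coupling by a time `t ∈ [0,1]` and approximate both components by slices of the
kernels at times `φ₁(t)` and `φ₂(t)`. The alignment must then carry `φ₁(t)` to `φ₂(t)`. -/
theorem cutDist_le_law (κ κ' : CutKernel Ω) :
    CutKernel.cutDist κ κ' ≤ ConfigLaw.cutDist κ.law κ'.law := by
  refine le_ciInf fun ⟨γ, ψ⟩ => le_of_forall_pos_le_add fun ε hε => ?_
  have := γ.isProb
  obtain ⟨p, hp, hpγ⟩ := γ.1.exists_measurable_map_eq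
  obtain ⟨φ₁, h1⟩ := exists_reparam_dist_slice_le κ (measurable_fst.comp hp)
    (by rw [← Measure.map_map measurable_fst hp, hpγ, γ.2.1]) (half_pos hε)
  obtain ⟨φ₂, h2⟩ := exists_reparam_dist_slice_le κ' (measurable_snd.comp hp)
    (by rw [← Measure.map_map measurable_snd hp, hpγ, γ.2.2]) (half_pos hε)
  refine (ciInf_le (f := fun p : Reparam × Reparam => CutKernel.discrepancy κ κ' p.1 p.2)
    ⟨0, by rintro _ ⟨p, rfl⟩; exact CutKernel.discrepancy_nonneg _ _ _ _⟩
    (φ₁.symm.trans φ₂, ψ)).trans ?_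
  refine CutKernel.discrepancy_le _ _ _ _
    (add_nonneg (ConfigLaw.discrepancy_nonneg _ _) hε.le) fun S X hS hX ω => ?_
  simp only [← CutKernel.defect_slice]
  let q : unitInterval → Config Ω × Config Ω := fun t => (κ.slice (φ₁ t), κ'.slice (φ₂ t))
  have hq : Measurable q := (κ.measurable_slice.comp φ₁.measurable).prodMk
    (κ'.measurable_slice.comp φ₂.measurable)
  have hs : ∀ s, (κ.slice s, κ'.slice (φ₁.symm.trans φ₂ s)) = q (φ₁.symm s) := fun s => by
    have : φ₁ (φ₁.symm s) = s := φ₁.1.apply_symm_apply s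
    simp only [q, this]
    rfl
  simp only [hs]
  -- Substituting `s = φ₁(t)` returns to the time scale of the coupling.
  rw [φ₁.symm.setIntegral_comp (fun t => Config.defect ψ X ω (q t)) S]
  set T := φ₁.symm '' S
  have hint : ∀ r : unitInterval → Config Ω × Config Ω, Measurable r →
      Integrable fun t => Config.defect ψ X ω (r t) := fun r hr =>
    Integrable.of_bound ((Config.measurable_defect ψ X ω).comp hr).aestronglyMeasurable 1
      (.of_forall fun t => Config.abs_defect_le ψ X ω _)
  have hdiff : |(∫ t in T, Config.defect ψ X ω (q t)) - ∫ t in T, Config.defect ψ X ω (p t)|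
      ≤ ε := by
    rw [← integral_sub (hint q hq).integrableOn (hint p hp).integrableOn]
    have := norm_setIntegral_le_of_norm_le_const_ae' (μ := volume) (s := T) (C := ε)
      (f := fun t => Config.defect ψ X ω (q t) - Config.defect ψ X ω (p t))
      (measure_lt_top _ _) (by
        filter_upwards [h1, h2] with t h1 h2 _
        refine (Config.abs_defect_sub_le ψ X ω (q t) (p t)).trans ?_
        have h1' : dist (q t).1 (p t).1 ≤ ε / 2 := h1
        have h2' : dist (q t).2 (p t).2 ≤ ε / 2 := h2
        linarith)
    exact this.trans (mul_le_of_le_one_right hε.le measureReal_le_one)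
  -- `T` need not be the preimage under `p` of a set of pairs; the bound survives because the sets
  -- of pairs with positive or with negative defect are the extremal tests.
  have hmain := ConfigLaw.abs_setIntegral_comp_le γ.1 ψ hX ω hp hpγ T
  have := abs_sub_abs_le_abs_sub (∫ t in T, Config.defect ψ X ω (q t))
    (∫ t in T, Config.defect ψ X ω (p t))
  linarith

theorem cutDist_law (κ κ' : CutKernel Ω) :
    ConfigLaw.cutDist κ.law κ'.law = CutKernel.cutDist κ κ' :=
  le_antisymm (cutDist_law_le κ κ') (cutDist_le_law κ κ')


/-! ### Every law is the law of a kernel -/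

/-- Configurations have representatives that depend measurably on the configuration. -/
theorem Config.exists_measurable_eval :
    ∃ E : Config Ω × unitInterval → stdSimplex ℝ Ω, Measurable E ∧
      ∀ σ : Config Ω, ∀ᵐ x, ∀ ω, (E (σ, x)).1 ω = σ.prob x ω := by
  classical
  have hq := fun n : ℕ => exists_measurable_quantizer (E := Config Ω)
    (pow_pos (one_half_pos (α := ℝ)) n)
  choose a d ha hd using hq
  -- Only countably many representatives occur at each level `n`, so joint measurability is
  -- automatic.
  let G : ℕ → Ω → Config Ω × unitInterval → ℝ := fun n ω q => (d n (a n q.1)).prob q.2 ω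
  have hG : ∀ n ω, Measurable (G n ω) := fun n ω => by
    have h : Measurable fun r : ℕ × unitInterval => (d n r.1).prob r.2 ω :=
      measurable_from_prod_countable_right fun j => (d n j).measurable_prob ω
    exact h.comp (((ha n).comp measurable_fst).prodMk measurable_snd)
  have hlim : ∀ (σ : Config Ω) (ω : Ω), ∀ᵐ x,
      Filter.Tendsto (fun n => G n ω (σ, x)) Filter.atTop (nhds (σ.prob x ω)) := by
    intro σ ω
    have hm : ∀ n, Measurable fun x => ENNReal.ofReal |G n ω (σ, x) - σ.prob x ω| := fun n =>
      (((hG n ω).comp measurable_prodMk_left).sub (σ.measurable_prob ω)).abs.ennreal_ofReal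
    have hb : ∀ n, ∫⁻ x, ENNReal.ofReal |G n ω (σ, x) - σ.prob x ω| ≤
        ENNReal.ofReal ((1 / 2) ^ n) := by
      intro n
      have hi : Integrable fun x => |σ.prob x ω - (d n (a n σ)).prob x ω| :=
        ((σ.integrable_prob ω).sub ((d n (a n σ)).integrable_prob ω)).abs
      have h1 : ∫ x, |σ.prob x ω - (d n (a n σ)).prob x ω| ≤ (1 / 2) ^ n :=
        (Finset.single_le_sum
          (f := fun ω => ∫ x, |σ.prob x ω - (d n (a n σ)).prob x ω|)
          (fun _ _ => integral_nonneg fun _ => abs_nonneg _) (Finset.mem_univ ω)).trans (hd n σ).le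
      simp only [G, abs_sub_comm _ (σ.prob _ ω)]
      rw [← ofReal_integral_eq_lintegral_ofReal hi (.of_forall fun _ => abs_nonneg _)]
      exact ENNReal.ofReal_le_ofReal h1
    -- Summability of the errors `2⁻ⁿ` upgrades `L¹` convergence to almost everywhere convergence
    -- without a subsequence, whose choice would depend on `σ`.
    have hsum : ∫⁻ x, ∑' n, ENNReal.ofReal |G n ω (σ, x) - σ.prob x ω| ≠ ⊤ := by
      rw [lintegral_tsum fun n => (hm n).aemeasurable]
      exact ne_top_of_le_ne_top summable_geometric_two.tsum_ofReal_ne_top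
        (ENNReal.tsum_le_tsum hb)
    filter_upwards [ae_lt_top (Measurable.tsum hm) hsum] with x hx
    have h0 := ENNReal.tendsto_atTop_zero_of_tsum_ne_top hx.ne
    have h0' := (ENNReal.tendsto_toReal ENNReal.zero_ne_top).comp h0
    rw [tendsto_iff_dist_tendsto_zero]
    refine h0'.congr fun n => ?_
    exact ENNReal.toReal_ofReal (abs_nonneg _)
  -- The limsup is measurable everywhere and equals the limit where that exists; the remaining
  -- values outside the simplex are replaced by the default `c`.
  let V : Config Ω × unitInterval → Ω → ℝ := fun q ω =>
    Filter.limsup (fun n => G n ω q) Filter.atTop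
  have hV : Measurable V := measurable_pi_lambda _ fun ω => .limsup fun n => hG n ω
  have hVlim : ∀ σ : Config Ω, ∀ᵐ x, V (σ, x) = (AEEqFun.cast σ x : stdSimplex ℝ Ω).1 := fun σ => by
    filter_upwards [ae_all_iff.2 (hlim σ)] with x hx
    exact funext fun ω => (hx ω).limsup_eq
  have hS : MeasurableSet (V ⁻¹' stdSimplex ℝ Ω) := hV (isClosed_stdSimplex ℝ Ω).measurableSet
  let c : stdSimplex ℝ Ω := ⟨_, single_mem_stdSimplex ℝ (Classical.arbitrary Ω)⟩
  refine ⟨fun q => if h : V q ∈ stdSimplex ℝ Ω then ⟨V q, h⟩ else c, ?_, fun σ => ?_⟩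
  · exact Measurable.dite (s := V ⁻¹' stdSimplex ℝ Ω)
      (f := fun q : V ⁻¹' stdSimplex ℝ Ω => (⟨V q, q.2⟩ : stdSimplex ℝ Ω)) (g := fun _ => c)
      (hV.comp measurable_subtype_coe).subtype_mk measurable_const hS
  · filter_upwards [hVlim σ] with x hx ω
    have h : V (σ, x) ∈ stdSimplex ℝ Ω := hx ▸ (AEEqFun.cast σ x : stdSimplex ℝ Ω).2
    rw [dif_pos h]
    exact congrFun hx ω

/-- A random configuration driven by a uniform time becomes a function of two variables once it is
evaluated through a jointly measurable representative. -/
theorem exists_law_eq (μ : ConfigLaw Ω) : ∃ κ : CutKernel Ω, κ.law = μ := by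
  obtain ⟨h, hm, hμ⟩ := μ.measure.exists_measurable_map_eq
  obtain ⟨E, hE, hEσ⟩ := Config.exists_measurable_eval (Ω := Ω)
  let K : unitInterval × unitInterval → stdSimplex ℝ Ω := fun q => E (h q.1, q.2)
  have hK : Measurable K := hE.comp ((hm.comp measurable_fst).prodMk measurable_snd)
  let κ : CutKernel Ω := (AEEqFun.mk K hK.aestronglyMeasurable :
    (unitInterval × unitInterval) →ₘ[(volume : Measure (unitInterval × unitInterval))]
      (stdSimplex ℝ Ω))
  have hκ : ∀ᵐ q : unitInterval × unitInterval, κ.val q.1 q.2 = K q :=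
    AEEqFun.coeFn_mk (μ := (volume : Measure (unitInterval × unitInterval))) K
      hK.aestronglyMeasurable
  -- `κ` remembers `K` only up to a null set of the square; by Fubini almost every section is
  -- unaffected.
  have hslice : κ.slice =ᵐ[volume] h := by
    filter_upwards [Measure.ae_ae_of_ae_prod hκ] with s hs
    refine Config.ext_ae fun ω => ?_
    filter_upwards [hs, hEσ (h s),
      Config.prob_mk (κ.val s) (κ.measurable_val.comp measurable_prodMk_left)] with x h1 h2 h3
    refine (h3 ω).trans ?_
    rw [h1]
    exact h2 ω
  refine ⟨κ, ?_⟩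
  obtain ⟨m, _⟩ := μ
  simp only [CutKernel.law, ConfigLaw.mk.injEq]
  exact (Measure.map_congr hslice).trans hμ

end CutMetric

/-! ### The induced isometry of the quotient spaces -/

theorem theorem1p3 (Ω : Type*) [Fintype Ω] [Nonempty Ω] :
    ∃ F : CutMetric.KernelSpace Ω ≃ᵢ CutMetric.LawSpace Ω,
      ∀ κ : CutMetric.CutKernel Ω,
        F (CutMetric.KernelSpace.mk κ) = CutMetric.LawSpace.mk κ.law := by
  have hiso : Isometry (CutMetric.CutKernel.law (Ω := Ω)) :=
    Isometry.of_dist_eq CutMetric.cutDist_law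
  let f : CutMetric.KernelSpace Ω → CutMetric.LawSpace Ω :=
    -- Inseparability means distance zero here, and the continuous map `law` preserves it.
    SeparationQuotient.lift (fun κ => CutMetric.LawSpace.mk κ.law) fun κ κ' h =>
      SeparationQuotient.mk_eq_mk.2 (h.map hiso.continuous)
  have hf : Isometry f := Isometry.of_dist_eq fun a b => by
    obtain ⟨κ, rfl⟩ := SeparationQuotient.surjective_mk a
    obtain ⟨κ', rfl⟩ := SeparationQuotient.surjective_mk b
    exact CutMetric.cutDist_law κ κ'
  have hs : Function.Surjective f := fun b => by
    obtain ⟨μ, rfl⟩ := SeparationQuotient.surjective_mk b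
    obtain ⟨κ, rfl⟩ := CutMetric.exists_law_eq μ
    exact ⟨CutMetric.KernelSpace.mk κ, rfl⟩
  exact ⟨⟨Equiv.ofBijective f ⟨hf.injective, hs⟩, hf⟩, fun κ => rfl⟩
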